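/- Let $G$ be a finite graph (loops and multiple edges are allowed) with vertex set $V$, $|V|=n$, and with a linearly ordered edge set $E(G)$. For $F\subseteq E(G)$ let $B_1,\dots,B_r$ be the vertex sets of the connected components of the spanning subgraph $(V,F)$, let $b_k=|B_k|$, and let $\mathfrak S_F=\mathfrak S_{B_1}\times\cdots\times\mathfrak S_{B_r}\le\mathfrak S_V$. Put $\mathcal L_b=\bigwedge^*\mathcal S^{(b-1,1)}\cong\bigoplus_{i=0}^{b-1}\mathcal S^{(b-i,1^i)}$ (graded by $i$; $\mathcal L_1=\mathbb C$ is trivial, in degree $0$), where $\mathcal S^{(b-1,1)}$ is the space of vectors in $\mathbb C^b$ with coordinate sum $0$, and let $$\mathcal M_F=\mathrm{Ind}_{\mathfrak S_F}^{\mathfrak S_V}(\mathcal L_{b_1}\otimes\cdots\otimes\mathcal L_{b_r})=\mathrm{Ind}_{\mathfrak S_F}^{\mathfrak S_V}\textstyle\bigwedge^*T_F,\qquad T_F=\bigoplus_k\mathcal S^{(b_k-1,1)}\subseteq\mathbb C^V,$$ a graded $\mathfrak S_V$-module over $\mathbb C$. For $i,j\ge0$ let $C_{i,j}(G)=\bigoplus_{|F|=i}(\mathcal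 M_F)_j$. For $e\in F$ let $d_{F,e}:\mathcal M_F\to\mathcal M_{F-e}$ be the identity if $F$ and $F-e$ have the same connected components; otherwise $T_F=T_{F-e}\oplus\mathbf 1$ as $\mathfrak S_{F-e}$-modules, and $d_{F,e}$ is the map induced (through Frobenius reciprocity) from the projection $\bigwedge^*T_F=\bigwedge^*T_{F-e}\oplus(\bigwedge^*T_{F-e})[1]\to\bigwedge^*T_{F-e}$. The differential $d_{i,j}:C_{i,j}(G)\to C_{i-1,j}(G)$ is given on $(\mathcal M_F)_j$ by $\sum_{e\in F}(-1)^{\#\{e'\in F:\,e'>e\}}\,d_{F,e}$. Let $H_{i,j}(G)=\ker d_{i,j}/\operatorname{im}d_{i+1,j}$ and $$\mathrm{Frob}_G(q,t)=\sum_{i,j\ge0}(-1)^{i+j}\,t^i q^j\,\mathrm{ch}\big(H_{i,j}(G)\big),$$ where $\mathrm{ch}$ is the Frobenius characteristic, $\mathrm{ch}(M)=\frac1{n!}\sum_{w\in\mathfrak S_V}\chi_M(w)\,p_{\lambda(w)}$, with $\lambda(w)$ the cycle type of $w$ and $p_\lambda$ the power sum symmetric functions (so that $\mathrm{ch}$ sends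 the Specht module $\mathcal S^\lambda$ to the Schur function $s_\lambda$). **Corollary.** If the edges $e_1,e_2,e_3\in E(G)$ form a triangle (they join $x$ to $y$, $y$ to $z$, and $z$ to $x$, for three distinct vertices $x,y,z$), then, as polynomials in $q$ with symmetric functions as coefficients, $$\mathrm{Frob}_G(q,1)=\mathrm{Frob}_{G-e_1}(q,1)+\mathrm{Frob}_{G-e_2}(q,1)-\mathrm{Frob}_{G-e_1-e_2}(q,1).$$ Here the edge sets of $G-e_1$, $G-e_2$ and $G-e_1-e_2$ carry the order inherited from $E(G)$. -/

import Mathlib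

open scoped DirectSum Graph

noncomputable section

namespace ChromaticHomology

/-! ### Symmetric functions and the Frobenius characteristic -/

/-- The ambient ring of power series in `x₀, x₁, x₂, …` with complex coefficients. The ring of
symmetric functions is its subring generated over `ℂ` by the power sums below. -/
abbrev SymmSeries : Type := MvPowerSeries ℕ ℂ

open Classical in
/-- The power sum `p_k = x₀ ^ k + x₁ ^ k + ⋯` (used for `k ≥ 1`). -/
def powerSum (k : ℕ) : SymmSeries :=
  fun m => if ∃ i : ℕ, m = Finsupp.single i k then 1 else 0

/-- The power sum symmetric function `p_λ = p_{λ₁} p_{λ₂} ⋯` of a partition. -/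
def powerSumPartition {n : ℕ} (lam : n.Partition) : SymmSeries :=
  (lam.parts.map powerSum).prod

open Classical in
/-- The Frobenius characteristic of a finite-dimensional complex representation of the symmetric
group on a finite set `V` with `n` elements:
`ch ρ = (1 / n!) ∑_w χ_ρ(w) p_{λ(w)}`, where `λ(w)` is the cycle type of `w` (fixed points
included); equivalently `∑_μ χ_ρ(μ) z_μ⁻¹ p_μ`. It sends the Specht module of shape `λ` to the
Schur function `s_λ`. -/
def frobChar {V : Type*} [Fintype V] {W : Type*} [AddCommGroup W] [Module ℂ W]
    (ρ : Representation ℂ (Equiv.Perm V) W) : SymmSeries :=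
  ((Nat.factorial (Fintype.card V) : ℂ)⁻¹) •
    ∑ w : Equiv.Perm V, ρ.character w • powerSumPartition w.partition

/-! ### The graded modules attached to a partition of the vertex set into blocks -/

/-- The exterior power of a representation. -/
def exteriorPowerRep {Γ : Type*} [Group Γ] {W : Type*} [AddCommGroup W] [Module ℂ W]
    (ρ : Representation ℂ Γ W) (j : ℕ) : Representation ℂ Γ (⋀[ℂ]^j W) where
  toFun g := exteriorPower.map j (ρ g)
  map_one' := by
    rw [map_one]; exact exteriorPower.map_id
  map_mul' g h := by
    rw [map_mul]; exact exteriorPower.map_comp (ρ h) (ρ g)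

section Blocks

variable {V : Type*} [Fintype V]

/-- The permutation representation of `𝔖_V` on `ℂ^V`: the basis vector `v` goes to `g v`. -/
def permRep (V : Type*) : Representation ℂ (Equiv.Perm V) (V → ℂ) where
  toFun g := LinearMap.funLeft ℂ ℂ (g⁻¹ : Equiv.Perm V)
  map_one' := by ext; simp
  map_mul' g h := by ext; simp [LinearMap.funLeft]

/-- The Young subgroup of `𝔖_V` that consists of the permutations preserving every block
(equivalence class) of `r`, that is, the product of the symmetric groups of the blocks. -/
def youngSubgroup {V : Type*} (r : Setoid V) : Subgroup (Equiv.Perm V) where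
  carrier := {g | ∀ v, r (g v) v}
  one_mem' v := r.refl v
  mul_mem' {g h} hg hh v := r.trans (hg (h v)) (hh v)
  inv_mem' {g} hg v := by
    have h := hg (g⁻¹ v)
    have h' : g (g⁻¹ v) = v := g.apply_symm_apply v
    rw [h'] at h
    exact r.symm h

open Classical in
/-- The sum of the coordinates of a vector over the block of `v`. -/
def blockSum (r : Setoid V) (v : V) : (V → ℂ) →ₗ[ℂ] ℂ :=
  ∑ u with r v u, LinearMap.proj u

open Classical in
/-- The number of elements in the block of `v`. -/
def blockCard (r : Setoid V) (v : V) : ℕ := (Finset.univ.filter fun u => r v u).card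

/-- The space of vectors in `ℂ^V` whose coordinates sum to zero over every block. It is the
direct sum, over the blocks `B`, of the standard representations `S^(|B|-1,1)` of `𝔖_B`
(which are zero for the blocks with one element). -/
def blockStd (r : Setoid V) : Submodule ℂ (V → ℂ) := ⨅ v, LinearMap.ker (blockSum r v)

theorem mem_blockStd {r : Setoid V} {f : V → ℂ} : f ∈ blockStd r ↔ ∀ v, blockSum r v f = 0 := by
  simp [blockStd]

theorem blockSum_congr {r : Setoid V} {v w : V} (h : r v w) : blockSum r v = blockSum r w := by
  classical
  unfold blockSum
  congr 1
  ext u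
  simp only [Finset.mem_filter, Finset.mem_univ, true_and]
  exact ⟨fun h' => r.trans (r.symm h) h', fun h' => r.trans h h'⟩

theorem blockCard_congr {r : Setoid V} {v w : V} (h : r v w) :
    blockCard r v = blockCard r w := by
  classical
  unfold blockCard
  congr 1
  ext u
  simp only [Finset.mem_filter, Finset.mem_univ, true_and]
  exact ⟨fun h' => r.trans (r.symm h) h', fun h' => r.trans h h'⟩

theorem blockCard_ne_zero (r : Setoid V) (v : V) : (blockCard r v : ℂ) ≠ 0 := by
  classical
  simp only [blockCard, ne_eq, Nat.cast_eq_zero, Finset.card_eq_zero]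
  exact Finset.ne_empty_of_mem (a := v) (by simp)

theorem blockSum_permRep {r : Setoid V} {g : Equiv.Perm V} (hg : g ∈ youngSubgroup r)
    (v : V) (f : V → ℂ) : blockSum r v (permRep V g f) = blockSum r v f := by
  classical
  have hg' : ∀ u, r (g⁻¹ u) u := inv_mem hg
  simp only [blockSum, LinearMap.sum_apply, LinearMap.proj_apply]
  refine Finset.sum_bij (fun u _ => g⁻¹ u) ?_ ?_ ?_ ?_
  · intro u hu
    simp only [Finset.mem_filter, Finset.mem_univ, true_and] at hu ⊢
    exact r.trans hu (r.symm (hg' u))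
  · intro a _ b _ h
    exact (g⁻¹).injective h
  · intro u hu
    simp only [Finset.mem_filter, Finset.mem_univ, true_and] at hu ⊢
    exact ⟨g u, r.trans hu (r.symm (hg u)), by simp⟩
  · intro u _
    rfl

/-- The representation of the Young subgroup of `r` on `blockStd r`. -/
def blockStdRep (r : Setoid V) : Representation ℂ (youngSubgroup r) (blockStd r) :=
  Representation.subrepresentation ((permRep V).comp (youngSubgroup r).subtype) (blockStd r)
      fun g f hf => by
    rw [Submodule.mem_comap, mem_blockStd]
    intro v
    exact (blockSum_permRep g.2 v f).trans (mem_blockStd.1 hf v)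

/-- The `j`-th graded piece of the outer tensor product of the modules
`L_b = ⋀^* S^(b-1,1) = ⨁ᵢ S^(b-i,1^i)` over the blocks of `r`, as a representation of the Young
subgroup: the exterior algebra of a direct sum is the tensor product of the exterior algebras. -/
abbrev blockRep (r : Setoid V) (j : ℕ) :
    Representation ℂ (youngSubgroup r) (⋀[ℂ]^j (blockStd r)) :=
  exteriorPowerRep (blockStdRep r) j

/-- The `j`-th graded piece of the module `M` obtained by inducing from the Young subgroup of `r`
to `𝔖_V`; the model of the induced module is the space of functions `f : 𝔖_V → W` with
`f (h g) = h • f g` for `h` in the subgroup. -/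
def IndModule (r : Setoid V) (j : ℕ) : Type _ :=
  Representation.coindV (youngSubgroup r).subtype (blockRep r j)

instance (r : Setoid V) (j : ℕ) : AddCommGroup (IndModule r j) :=
  inferInstanceAs (AddCommGroup (Representation.coindV (youngSubgroup r).subtype (blockRep r j)))

instance (r : Setoid V) (j : ℕ) : Module ℂ (IndModule r j) :=
  inferInstanceAs (Module ℂ (Representation.coindV (youngSubgroup r).subtype (blockRep r j)))

/-- The action of `𝔖_V` on the induced module. -/
def indRep (r : Setoid V) (j : ℕ) : Representation ℂ (Equiv.Perm V) (IndModule r j) :=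
  Representation.coind (youngSubgroup r).subtype (blockRep r j)

/-- The equivariant projection of `ℂ^V` onto `blockStd r`: subtract from every coordinate the mean
over its block. -/
def blockProj (r : Setoid V) : (V → ℂ) →ₗ[ℂ] blockStd r :=
  LinearMap.codRestrict (blockStd r)
    (LinearMap.id - LinearMap.pi fun v => (blockCard r v : ℂ)⁻¹ • blockSum r v) fun f => by
      classical
      rw [mem_blockStd]
      intro v
      have h : ∀ u, r v u → ((blockCard r u : ℂ)⁻¹ • blockSum r u) f
          = ((blockCard r v : ℂ)⁻¹ • blockSum r v) f := fun u hu => by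
        rw [blockCard_congr hu, blockSum_congr hu]
      have h0 := blockCard_ne_zero r v
      rw [LinearMap.sub_apply, map_sub, sub_eq_zero, LinearMap.id_apply]
      conv_rhs => rw [blockSum, LinearMap.sum_apply]
      rw [Finset.sum_congr rfl fun u hu => by
        rw [LinearMap.proj_apply, LinearMap.pi_apply, h u (Finset.mem_filter.1 hu).2],
        Finset.sum_const, ← blockCard, LinearMap.smul_apply, nsmul_eq_mul, smul_eq_mul,
        mul_inv_cancel_left₀ h0]

theorem blockProj_apply (r : Setoid V) (f : V → ℂ) (v : V) :
    (blockProj r f : V → ℂ) v = f v - (blockCard r v : ℂ)⁻¹ * blockSum r v f := rfl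

/-- The projection `blockStd r → blockStd r'`, for `r'` finer than `r`. When a block of `r` splits
into two blocks `A` and `B` of `r'`, then `blockStd r = blockStd r' ⊕ 𝟏`, where the trivial
summand `𝟏` is spanned by `|B| 1_A - |A| 1_B`, and this map is the identity on the first summand
and zero on the second. When `r' = r` it is the identity. -/
def splitMap (r r' : Setoid V) : blockStd r →ₗ[ℂ] blockStd r' :=
  blockProj r' ∘ₗ (blockStd r).subtype

theorem youngSubgroup_mono {V : Type*} {r r' : Setoid V} (h : r' ≤ r) :
    youngSubgroup r' ≤ youngSubgroup r := fun _ hg v => h (hg v)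

theorem splitMap_comm {r r' : Setoid V} (h : r' ≤ r) (g : youngSubgroup r') :
    splitMap r r' ∘ₗ blockStdRep r ⟨g, youngSubgroup_mono h g.2⟩
      = blockStdRep r' g ∘ₗ splitMap r r' := by
  ext f v
  have hg' : r' ((g : Equiv.Perm V)⁻¹ v) v := (inv_mem g.2 : (g : Equiv.Perm V)⁻¹ ∈ _) v
  change (permRep V g f.1) v - (blockCard r' v : ℂ)⁻¹ * blockSum r' v (permRep V g f.1)
    = f.1 ((g : Equiv.Perm V)⁻¹ v) - (blockCard r' ((g : Equiv.Perm V)⁻¹ v) : ℂ)⁻¹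
      * blockSum r' ((g : Equiv.Perm V)⁻¹ v) f.1
  rw [blockSum_permRep g.2, blockCard_congr hg', blockSum_congr hg']
  rfl

/-- The per-edge map between the induced modules, for `r'` finer than `r`: on the `j`-th graded
piece it is induced from the projection `⋀^j (blockStd r) → ⋀^j (blockStd r')`. When one block of
`r` splits into two blocks of `r'`, the projection is the identity on `⋀^* T` and zero on
`(⋀^* T)[1]` in the decomposition `⋀^* (T ⊕ 𝟏) = ⋀^* T ⊕ (⋀^* T)[1]`, where `T = blockStd r'`.
When `r' = r`, the per-edge map is the identity. -/
def edgeMap {r r' : Setoid V} (h : r' ≤ r) (j : ℕ) : IndModule r j →ₗ[ℂ] IndModule r' j :=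
  LinearMap.restrict (p := Representation.coindV (youngSubgroup r).subtype (blockRep r j))
      (q := Representation.coindV (youngSubgroup r').subtype (blockRep r' j))
      ((exteriorPower.map j (splitMap r r')).compLeft (Equiv.Perm V)) fun f hf g x => by
    have h1 := hf ⟨g, youngSubgroup_mono h g.2⟩ x
    have h2 : exteriorPower.map j (splitMap r r') ∘ₗ
        exteriorPower.map j (blockStdRep r ⟨g, youngSubgroup_mono h g.2⟩)
        = exteriorPower.map j (blockStdRep r' g) ∘ₗ exteriorPower.map j (splitMap r r') := by
      rw [← exteriorPower.map_comp, ← exteriorPower.map_comp, splitMap_comm h]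
    change exteriorPower.map j (splitMap r r') (f ((g : Equiv.Perm V) * x))
      = exteriorPower.map j (blockStdRep r' g) (exteriorPower.map j (splitMap r r') (f x))
    have h3 : f ((g : Equiv.Perm V) * x)
        = exteriorPower.map j (blockStdRep r ⟨g, youngSubgroup_mono h g.2⟩) (f x) := h1
    rw [h3]
    exact LinearMap.congr_fun h2 (f x)

theorem edgeMap_comm {r r' : Setoid V} (h : r' ≤ r) (j : ℕ) (g : Equiv.Perm V)
    (x : IndModule r j) : edgeMap h j (indRep r j g x) = indRep r' j g (edgeMap h j x) := rfl

end Blocks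

/-! ### The chain complex of a graph -/

variable {α β : Type*}

/-- The states of a graph with exactly `i` edges, as sets of edges: a state is a spanning
subgraph. -/
abbrev State (G : Graph α β) (i : ℕ) : Type _ := {F : Finset β // (F : Set β) ⊆ E(G) ∧ F.card = i}

/-- The partition of the vertex set into the connected components of the spanning subgraph with
edge set `F`. -/
def components (G : Graph α β) (F : Finset β) : Setoid V(G) :=
  Relation.EqvGen.setoid fun u v => ∃ e ∈ F, G.IsLink e u v

theorem components_mono (G : Graph α β) {F F' : Finset β} (h : F' ⊆ F) :
    components G F' ≤ components G F := by
  intro u v huv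
  exact Relation.EqvGen.mono (fun a b ⟨e, he, hl⟩ => ⟨e, h he, hl⟩) u v huv

variable [Fintype α] [LinearOrder β]

open Classical in
instance (G : Graph α β) : Fintype V(G) := inferInstance

/-- The chain module `C_{i,j}(G)`, the direct sum of the modules `(M_F)_j` over the states `F` with
`i` edges. -/
abbrev Chain (G : Graph α β) (i j : ℕ) : Type _ :=
  ⨁ F : State G i, IndModule (components G F.1) j

/-- The action of the symmetric group of the vertex set on the chain module. -/
abbrev chainRep (G : Graph α β) (i j : ℕ) : Representation ℂ (Equiv.Perm V(G)) (Chain G i j) :=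
  Representation.directSum fun F : State G i => indRep (components G F.1) j

/-- The state obtained by removing an edge. -/
def State.erase {G : Graph α β} {i : ℕ} (F : State G (i + 1)) (e : {e // e ∈ F.1}) : State G i :=
  ⟨F.1.erase e, fun _ hx => F.2.1 (Finset.mem_of_mem_erase hx), by
    rw [Finset.card_erase_of_mem e.2, F.2.2]; rfl⟩

/-- The sign of the edge `F → F - e` of the state diagram: `(-1)^k`, where `k` is the number of
edges of `F` that come after `e`. -/
def edgeSign (F : Finset β) (e : β) : ℂ := (-1) ^ (F.filter fun e' => e < e').card

/-- The differential `d_{i+1,j} : C_{i+1,j}(G) → C_{i,j}(G)`, the sum of the signed per-edge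
maps. -/
def differential (G : Graph α β) (i j : ℕ) : Chain G (i + 1) j →ₗ[ℂ] Chain G i j :=
  DirectSum.toModule ℂ (State G (i + 1)) (Chain G i j) fun F =>
    ∑ e : {e // e ∈ F.1}, edgeSign F.1 e •
      (DirectSum.lof ℂ (State G i) (fun F' => IndModule (components G F'.1) j) (F.erase e) ∘ₗ
        edgeMap (components_mono G (Finset.erase_subset e.1 F.1)) j)

theorem differential_comm (G : Graph α β) (i j : ℕ) (g : Equiv.Perm V(G)) (x : Chain G (i + 1) j) :
    differential G i j (chainRep G (i + 1) j g x) = chainRep G i j g (differential G i j x) := by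
  suffices h : differential G i j ∘ₗ chainRep G (i + 1) j g
      = chainRep G i j g ∘ₗ differential G i j from LinearMap.congr_fun h x
  refine DirectSum.linearMap_ext ℂ fun F => LinearMap.ext fun y => ?_
  simp only [differential, LinearMap.comp_apply, DirectSum.toModule_lof, chainRep,
    Representation.directSum_apply, DirectSum.lmap_lof, LinearMap.sum_apply, LinearMap.smul_apply,
    map_sum, map_smul]
  refine Finset.sum_congr rfl fun e _ => congrArg _ ?_
  exact (DirectSum.lmap_lof (fun F' : State G i => indRep (components G F'.1) j g) (F.erase e)
    (edgeMap (components_mono G (Finset.erase_subset e.1 F.1)) j y)).symm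

/-- The cycles: the kernel of `d_{i,j}`, where `d_{0,j} = 0`. -/
def cycles (G : Graph α β) : (i j : ℕ) → Submodule ℂ (Chain G i j)
  | 0, _ => ⊤
  | i + 1, j => LinearMap.ker (differential G i j)

/-- The boundaries: the image of `d_{i+1,j}`. -/
def boundaries (G : Graph α β) (i j : ℕ) : Submodule ℂ (Chain G i j) :=
  LinearMap.range (differential G i j)

theorem cycles_le_comap (G : Graph α β) (i j : ℕ) (g : Equiv.Perm V(G)) :
    cycles G i j ≤ (cycles G i j).comap (chainRep G i j g) := by
  cases i with
  | zero => exact fun _ _ => Submodule.mem_top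
  | succ i =>
    intro x hx
    have hx' : differential G i j x = 0 := hx
    change differential G i j (chainRep G (i + 1) j g x) = 0
    rw [differential_comm, hx', map_zero]

theorem boundaries_le_comap (G : Graph α β) (i j : ℕ) (g : Equiv.Perm V(G)) :
    boundaries G i j ≤ (boundaries G i j).comap (chainRep G i j g) := by
  rintro _ ⟨x, rfl⟩
  exact ⟨chainRep G (i + 1) j g x, differential_comm G i j g x⟩

/-- The homology `H_{i,j}(G) = ker d_{i,j} / im d_{i+1,j}`. -/
abbrev Homology (G : Graph α β) (i j : ℕ) : Type _ :=
  cycles G i j ⧸ (boundaries G i j).submoduleOf (cycles G i j)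

/-- The action of the symmetric group of the vertex set on the homology. -/
def homologyRep (G : Graph α β) (i j : ℕ) :
    Representation ℂ (Equiv.Perm V(G)) (Homology G i j) :=
  ((chainRep G i j).subrepresentation (cycles G i j) (cycles_le_comap G i j)).quotient
    ((boundaries G i j).submoduleOf (cycles G i j)) fun g _ hx => boundaries_le_comap G i j g hx

/-- The bigraded Frobenius series `Frob_G(q,t) = ∑_{i,j} (-1)^(i+j) t^i q^j ch H_{i,j}(G)`, as a
polynomial in `t` whose coefficients are polynomials in `q`. The terms with more than `|E(G)|`
edges or with `j > |V(G)|` are zero, since the chain modules are. -/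
def frobSeries (G : Graph α β) : Polynomial (Polynomial SymmSeries) :=
  ∑ i ∈ Finset.range (E(G).ncard + 1), ∑ j ∈ Finset.range (V(G).ncard + 1),
    Polynomial.monomial i (Polynomial.monomial j
      ((-1 : SymmSeries) ^ (i + j) * frobChar (homologyRep G i j)))

end ChromaticHomology

end

noncomputable section

namespace ChromaticHomology

/-! ### Additivity of traces and of the Frobenius characteristic -/

/-! At t = 1 the Frobenius series is an Euler characteristic in the homological degree. The
Frobenius characteristic is additive on equivariant short exact sequences, so for each j the
alternating sum of ch H_{i,j} equals the sum of (-1)^|F| ch (M_F)_j over all states F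
(`sum_frobChar_homologyRep`). About the differential this needs only equivariance and d² = 0.

The module M_F depends on F only through its connected components. By inclusion-exclusion over the
states that avoid e₁ or e₂, the claim says that the states containing both e₁ and e₂ contribute zero
in total. For such F the ends of e₃ are already connected, so adding or removing e₃ keeps M_F and
flips the sign, and the states cancel in pairs (`eulerSum_triangle`). -/

/-- The trace is additive on short exact sequences. -/
theorem trace_eq_add_of_exact {K N W Q : Type*} [Field K] [AddCommGroup N] [Module K N]
    [AddCommGroup W] [Module K W] [FiniteDimensional K W] [AddCommGroup Q] [Module K Q]
    {ι : N →ₗ[K] W} {p : W →ₗ[K] Q} (hι : Function.Injective ι) (hp : Function.Surjective p)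
    (hex : Function.Exact ι p) {a : N →ₗ[K] N} {f : W →ₗ[K] W} {b : Q →ₗ[K] Q}
    (ha : f ∘ₗ ι = ι ∘ₗ a) (hb : p ∘ₗ f = b ∘ₗ p) :
    LinearMap.trace K W f = LinearMap.trace K N a + LinearMap.trace K Q b := by
  have : FiniteDimensional K N := Module.Finite.of_injective ι hι
  have : FiniteDimensional K Q := Module.Finite.of_surjective p hp
  obtain ⟨s, hs⟩ := p.exists_rightInverse_of_surjective (LinearMap.range_eq_top.2 hp)
  obtain ⟨π, hπ⟩ := ι.exists_leftInverse_of_injective (LinearMap.ker_eq_bot.2 hι)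
  have hq : ∀ w, ∃ n, ι n = w - s (p w) := fun w => by
    refine (hex _).1 ?_
    rw [map_sub, sub_eq_zero]
    exact (LinearMap.congr_fun hs (p w)).symm
  -- The identity of W is split along linear sections `s` and `π`, which need not commute with `f`.
  -- Cyclicity of the trace carries the two parts of `f` to N and Q, where `a` and `b` appear.
  have hid : ι ∘ₗ π ∘ₗ (LinearMap.id - s ∘ₗ p) + s ∘ₗ p = LinearMap.id := by
    ext w
    obtain ⟨n, hn⟩ := hq w
    have h := LinearMap.congr_fun hπ n
    simp only [LinearMap.comp_apply, LinearMap.id_apply] at h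
    simp [← hn, h]
    simp [hn]
  have hpι : p ∘ₗ ι = 0 := LinearMap.ext fun n => (hex _).2 ⟨n, rfl⟩
  have h1 : LinearMap.trace K W (f ∘ₗ ι ∘ₗ π ∘ₗ (LinearMap.id - s ∘ₗ p))
      = LinearMap.trace K N a := by
    rw [← LinearMap.comp_assoc, LinearMap.trace_comp_comm', ha]
    congr 1
    ext n
    have h := LinearMap.congr_fun hπ (a n)
    have h' := LinearMap.congr_fun hpι (a n)
    simp only [LinearMap.comp_apply, LinearMap.id_apply, LinearMap.zero_apply] at h h'
    simp [h, h']
  have h2 : LinearMap.trace K W (f ∘ₗ s ∘ₗ p) = LinearMap.trace K Q b := by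
    rw [← LinearMap.comp_assoc, LinearMap.trace_comp_comm', ← LinearMap.comp_assoc, hb,
      LinearMap.comp_assoc, hs, LinearMap.comp_id]
  rw [← h1, ← h2, ← map_add, ← LinearMap.comp_add, hid, LinearMap.comp_id]

/-- The identity is the sum of the maps `lof i ∘ component i`; cyclicity of the trace turns the i-th
term into the trace of `f i`. -/
theorem trace_lmap {K ι : Type*} [Field K] [Fintype ι] [DecidableEq ι] {W : ι → Type*}
    [∀ i, AddCommGroup (W i)] [∀ i, Module K (W i)] [∀ i, FiniteDimensional K (W i)]
    (f : ∀ i, W i →ₗ[K] W i) :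
    LinearMap.trace K (⨁ i, W i) (DirectSum.lmap f) = ∑ i, LinearMap.trace K (W i) (f i) := by
  have hid : ∑ i, DirectSum.lof K ι W i ∘ₗ DirectSum.component K ι W i = LinearMap.id := by
    refine DirectSum.linearMap_ext K fun i => LinearMap.ext fun w => ?_
    rw [LinearMap.comp_apply, LinearMap.sum_apply, Finset.sum_eq_single i]
    · simp [DirectSum.component.lof_self]
    · intro j _ hj
      rw [LinearMap.comp_apply, DirectSum.component.of, dif_neg hj.symm, map_zero]
    · simp
  have hf : DirectSum.lmap f
      = ∑ i, DirectSum.lmap f ∘ₗ DirectSum.lof K ι W i ∘ₗ DirectSum.component K ι W i := by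
    refine LinearMap.ext fun w => ?_
    conv_lhs => rw [← LinearMap.id_apply (R := K) w, ← hid]
    simp only [LinearMap.sum_apply, LinearMap.comp_apply, map_sum]
  rw [hf, map_sum]
  refine Finset.sum_congr rfl fun i _ => ?_
  rw [← LinearMap.comp_assoc, LinearMap.trace_comp_comm']
  congr 1
  ext w
  simp [DirectSum.lmap_lof, DirectSum.component.lof_self]

section FrobChar

variable {V : Type*} [Fintype V] {N W Q : Type*} [AddCommGroup N] [Module ℂ N]
  [AddCommGroup W] [Module ℂ W] [AddCommGroup Q] [Module ℂ Q]

theorem frobChar_eq_add_of_exact [FiniteDimensional ℂ W]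
    {ρN : Representation ℂ (Equiv.Perm V) N}
    {ρ : Representation ℂ (Equiv.Perm V) W} {ρQ : Representation ℂ (Equiv.Perm V) Q}
    {ι : N →ₗ[ℂ] W} {p : W →ₗ[ℂ] Q} (hι : Function.Injective ι) (hp : Function.Surjective p)
    (hex : Function.Exact ι p) (hN : ∀ g, ρ g ∘ₗ ι = ι ∘ₗ ρN g)
    (hQ : ∀ g, p ∘ₗ ρ g = ρQ g ∘ₗ p) :
    frobChar ρ = frobChar ρN + frobChar ρQ := by
  simp only [frobChar, ← smul_add, ← Finset.sum_add_distrib, ← add_smul]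
  congr 1
  exact Finset.sum_congr rfl fun g _ => congrArg (· • _)
    (trace_eq_add_of_exact hι hp hex (hN g) (hQ g))

theorem frobChar_of_subsingleton [Subsingleton W] (ρ : Representation ℂ (Equiv.Perm V) W) :
    frobChar ρ = 0 := by
  have h : ∀ g, ρ.character g = 0 := fun g => by
    rw [Representation.character, Subsingleton.elim (ρ g) 0, map_zero]
  simp [frobChar, h]

theorem frobChar_directSum {ι : Type*} [Fintype ι] {M : ι → Type*} [∀ i, AddCommGroup (M i)]
    [∀ i, Module ℂ (M i)] [∀ i, FiniteDimensional ℂ (M i)]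
    (ρ : ∀ i, Representation ℂ (Equiv.Perm V) (M i)) :
    frobChar (Representation.directSum ρ) = ∑ i, frobChar (ρ i) := by
  classical
  have h : ∀ g, (Representation.directSum ρ).character g = ∑ i, (ρ i).character g := fun g =>
    trace_lmap fun i => ρ i g
  simp only [frobChar, h, Finset.sum_smul, ← Finset.smul_sum]
  rw [Finset.sum_comm]

end FrobChar

/-! ### The differential squares to zero -/

section Blocks

variable {V : Type*} [Fintype V]

instance (r : Setoid V) (j : ℕ) : FiniteDimensional ℂ (IndModule r j) :=
  inferInstanceAs (FiniteDimensional ℂ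
    (Representation.coindV (youngSubgroup r).subtype (blockRep r j)))

/-- Means over blocks of `r'` are constant on the smaller blocks of `r''`, so subtracting them first
does not change the result of centering over `r''`. -/
theorem splitMap_comp {r r' r'' : Setoid V} (h' : r'' ≤ r') :
    splitMap r' r'' ∘ₗ splitMap r r' = splitMap r r'' := by
  classical
  ext f v
  have h0 := blockCard_ne_zero r'' v
  have hs : blockSum r'' v (blockProj r' f.1 : V → ℂ)
      = blockSum r'' v f.1 - blockCard r'' v * ((blockCard r' v : ℂ)⁻¹ * blockSum r' v f.1) := by
    simp only [blockSum, LinearMap.sum_apply, LinearMap.proj_apply]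
    rw [Finset.sum_congr rfl fun u hu => by
      have hu' : r' v u := h' (Finset.mem_filter.1 hu).2
      rw [blockProj_apply, ← blockCard_congr hu', ← blockSum_congr hu'],
      Finset.sum_sub_distrib, Finset.sum_const, ← blockCard, nsmul_eq_mul]
    simp [blockSum]
  change (blockProj r' f.1 : V → ℂ) v
      - (blockCard r'' v : ℂ)⁻¹ * blockSum r'' v (blockProj r' f.1 : V → ℂ)
    = f.1 v - (blockCard r'' v : ℂ)⁻¹ * blockSum r'' v f.1
  rw [hs, blockProj_apply]
  field_simp
  ring

/-- A composite depends only on its source and target partitions, so the per-edge maps commute when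
two edges are removed in either order. -/
theorem edgeMap_edgeMap {r r' r'' : Setoid V} (h : r' ≤ r) (h' : r'' ≤ r') (j : ℕ)
    (x : IndModule r j) : edgeMap h' j (edgeMap h j x) = edgeMap (h'.trans h) j x := by
  refine Subtype.ext (funext fun g => ?_)
  change exteriorPower.map j (splitMap r' r'') (exteriorPower.map j (splitMap r r') (x.1 g))
    = exteriorPower.map j (splitMap r r'') (x.1 g)
  rw [← LinearMap.comp_apply, ← exteriorPower.map_comp, splitMap_comp h']

end Blocks

/-- For e < f, removing e does not affect the number of edges after f, while removing f lowers the
number after e by one. Hence the signed squares anticommute. -/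
theorem edgeSign_mul_add {β : Type*} [LinearOrder β] {F : Finset β} {e f : β} (he : e ∈ F)
    (hf : f ∈ F) (hne : e ≠ f) :
    edgeSign F e * edgeSign (F.erase e) f + edgeSign F f * edgeSign (F.erase f) e = 0 := by
  wlog h : e < f generalizing e f
  · rw [add_comm]
    exact this hf he hne.symm (lt_of_le_of_ne (not_lt.1 h) hne.symm)
  have h1 : edgeSign (F.erase e) f = edgeSign F f := by
    unfold edgeSign
    rw [Finset.filter_erase, Finset.erase_eq_of_notMem]
    simp [h.le]
  have h2 : edgeSign F e = -edgeSign (F.erase f) e := by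
    unfold edgeSign
    rw [Finset.filter_erase,
      ← Finset.card_erase_add_one (Finset.mem_filter.2 ⟨hf, h⟩ : f ∈ F.filter fun e' => e < e'),
      pow_succ]
    ring
  rw [h1, h2]
  ring

/-! ### Components of spanning subgraphs and the alternating sum over states -/

theorem card_le_ncard_edgeSet {α β : Type*} [Finite β] {G : Graph α β} {F : Finset β} (hF : (F : Set β) ⊆ E(G)) :
    F.card ≤ E(G).ncard := by
  rw [← Set.ncard_coe_finset]
  exact Set.ncard_le_ncard hF

theorem components_insert {α β : Type*} [DecidableEq β] {G : Graph α β} {F : Finset β} {e : β} {u v : V(G)}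
    (he : G.IsLink e u v) (huv : components G F u v) :
    components G (insert e F) = components G F := by
  refine le_antisymm (Setoid.eqvGen_le ?_) (components_mono G (Finset.subset_insert e F))
  rintro a b ⟨f, hf, hl⟩
  rcases Finset.mem_insert.1 hf with rfl | hf
  · rcases he.eq_and_eq_or_eq_and_eq hl with ⟨h, h'⟩ | ⟨h, h'⟩
    · rwa [← Subtype.ext h, ← Subtype.ext h']
    · rw [← Subtype.ext h, ← Subtype.ext h']
      exact (components G F).symm huv
  · exact Relation.EqvGen.rel _ _ ⟨f, hf, hl⟩

open Classical in
/-- The alternating sum over all states of the characteristics of the `j`-th graded pieces. -/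
def eulerSum {α β : Type*} [Fintype α] [Fintype β] (G : Graph α β) (j : ℕ) : SymmSeries :=
  ∑ F ∈ Finset.univ.filter fun F : Finset β => (F : Set β) ⊆ E(G),
    (-1) ^ F.card * frobChar (indRep (components G F) j)

-- This puts the sums for G and for its edge deletions on a common footing: the same summand, with
-- components taken in G, over different families of edge sets.
open Classical in
theorem eulerSum_deleteEdges {α β : Type*} [Fintype α] [Fintype β] (G : Graph α β) (D : Set β) (j : ℕ) :
    eulerSum (G.deleteEdges D) j = ∑ F ∈ Finset.univ.filter fun F : Finset β => (F : Set β) ⊆ E(G) \ D,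
      (-1) ^ F.card * frobChar (indRep (components G F) j) := by
  refine Finset.sum_congr rfl fun F hF => ?_
  have hF' : (F : Set β) ⊆ E(G) \ D := (Finset.mem_filter.1 hF).2
  have h : components (G.deleteEdges D) F = components G F := by
    refine congrArg Relation.EqvGen.setoid (funext fun u => funext fun v => propext ?_)
    exact ⟨fun ⟨e, he, hl⟩ => ⟨e, he, hl.1⟩, fun ⟨e, he, hl⟩ => ⟨e, he, hl, (hF' he).2⟩⟩
  -- The vertex type of `G.deleteEdges D` is definitionally that of G, so both partitions can be
  -- read as setoids on `V(G)`.
  exact congrArg (fun r : Setoid V(G) => (-1) ^ F.card * frobChar (indRep r j)) h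

variable {α β : Type*} [Fintype α] [LinearOrder β]

/-- Erasing two edges in different orders gives states that are equal but not definitionally so;
this transports between the corresponding summands. -/
theorem lof_edgeMap_congr {G : Graph α β} {i j : ℕ} {r : Setoid V(G)} {S S' : State G i}
    (hS : S = S') (h : components G S.1 ≤ r) (h' : components G S'.1 ≤ r) (x : IndModule r j) :
    DirectSum.lof ℂ (State G i) (fun F' => IndModule (components G F'.1) j) S (edgeMap h j x)
      = DirectSum.lof ℂ (State G i) (fun F' => IndModule (components G F'.1) j) S'
        (edgeMap h' j x) := by
  subst hS; rfl

theorem differential_lof (G : Graph α β) (i j : ℕ) (F : State G (i + 1))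
    (y : IndModule (components G F.1) j) :
    differential G i j
        (DirectSum.lof ℂ (State G (i + 1)) (fun F' => IndModule (components G F'.1) j) F y)
      = ∑ e : {e // e ∈ F.1}, edgeSign F.1 e •
        DirectSum.lof ℂ (State G i) (fun F' => IndModule (components G F'.1) j) (F.erase e)
          (edgeMap (r' := components G (F.erase e).1)
            (components_mono G (Finset.erase_subset e.1 F.1)) j y) := by
  rw [differential, DirectSum.toModule_lof, LinearMap.sum_apply]
  rfl

theorem differential_differential (G : Graph α β) (i j : ℕ) (x : Chain G (i + 2) j) :
    differential G i j (differential G (i + 1) j x) = 0 := by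
  suffices h : differential G i j ∘ₗ differential G (i + 1) j = 0 from LinearMap.congr_fun h x
  refine DirectSum.linearMap_ext ℂ fun F => LinearMap.ext fun y => ?_
  simp only [LinearMap.comp_apply, differential_lof, map_sum, map_smul, LinearMap.zero_apply,
    Finset.smul_sum, smul_smul]
  rw [Finset.sum_sigma']
  -- The involution exchanges the order in which the two edges are removed.
  refine Finset.sum_involution
    (fun p _ => ⟨⟨p.2.1, Finset.mem_of_mem_erase p.2.2⟩,
      ⟨p.1.1, Finset.mem_erase.2 ⟨(Finset.ne_of_mem_erase p.2.2).symm, p.1.2⟩⟩⟩)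
    ?_ ?_ (fun _ _ => by simp) (fun _ _ => rfl)
  · rintro ⟨⟨e, he⟩, ⟨f, hf⟩⟩ -
    have hfe := Finset.mem_erase.1 hf
    simp only [edgeMap_edgeMap]
    rw [lof_edgeMap_congr (S := (F.erase ⟨f, hfe.2⟩).erase
        ⟨e, Finset.mem_erase.2 ⟨hfe.1.symm, he⟩⟩) (S' := (F.erase ⟨e, he⟩).erase ⟨f, hf⟩)
      (Subtype.ext Finset.erase_right_comm)
      _ (components_mono G ((Finset.erase_subset _ _).trans (Finset.erase_subset _ _))),
      ← add_smul]
    convert zero_smul ℂ _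
    exact edgeSign_mul_add he hfe.2 hfe.1.symm
  · rintro ⟨⟨e, he⟩, ⟨f, hf⟩⟩ - - h
    exact (Finset.mem_erase.1 hf).1 (congrArg (fun p => p.1.1) h)

theorem boundaries_le_cycles (G : Graph α β) (i j : ℕ) : boundaries G i j ≤ cycles G i j := by
  cases i with
  | zero => exact le_top
  | succ i =>
    rintro _ ⟨x, rfl⟩
    exact differential_differential G i j x

/-! ### The Euler characteristic -/

/-- The action of the symmetric group of the vertex set on the cycles. -/
abbrev cyclesRep (G : Graph α β) (i j : ℕ) : Representation ℂ (Equiv.Perm V(G)) (cycles G i j) :=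
  (chainRep G i j).subrepresentation (cycles G i j) (cycles_le_comap G i j)

/-- The action of the symmetric group of the vertex set on the boundaries. -/
abbrev boundariesRep (G : Graph α β) (i j : ℕ) :
    Representation ℂ (Equiv.Perm V(G)) (boundaries G i j) :=
  (chainRep G i j).subrepresentation (boundaries G i j) (boundaries_le_comap G i j)

variable [Fintype β]

open Classical in
instance (G : Graph α β) (i : ℕ) : Fintype (State G i) := inferInstance

instance (G : Graph α β) (i j : ℕ) : FiniteDimensional ℂ (Chain G i j) := inferInstance

/-- Additivity on 0 → Z_{i+1} → C_{i+1} → B_i → 0, where the surjection is the differential. -/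
theorem frobChar_chainRep_succ (G : Graph α β) (i j : ℕ) :
    frobChar (chainRep G (i + 1) j)
      = frobChar (cyclesRep G (i + 1) j) + frobChar (boundariesRep G i j) :=
  frobChar_eq_add_of_exact (ι := (cycles G (i + 1) j).subtype)
    (p := (differential G i j).rangeRestrict) (Submodule.subtype_injective _)
    (LinearMap.surjective_rangeRestrict _)
    (fun x => ⟨fun h => ⟨⟨x, congrArg Subtype.val h⟩, rfl⟩, by
      rintro ⟨y, rfl⟩
      exact Subtype.ext y.2⟩)
    (fun g => rfl)
    (fun g => LinearMap.ext fun x => Subtype.ext (differential_comm G i j g x))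

theorem frobChar_chainRep_zero (G : Graph α β) (j : ℕ) :
    frobChar (chainRep G 0 j) = frobChar (cyclesRep G 0 j) := by
  have h := frobChar_eq_add_of_exact (ρ := chainRep G 0 j) (ρN := cyclesRep G 0 j)
    (ρQ := (1 : Representation ℂ (Equiv.Perm V(G)) PUnit))
    (ι := (cycles G 0 j).subtype) (p := 0) (Submodule.subtype_injective _)
    (fun x => ⟨0, rfl⟩) (fun x => ⟨fun _ => ⟨⟨x, trivial⟩, rfl⟩, fun _ => rfl⟩)
    (fun g => rfl) (fun g => rfl)
  rw [h, frobChar_of_subsingleton (1 : Representation ℂ (Equiv.Perm V(G)) PUnit), add_zero]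

/-- Additivity on 0 → B_i → Z_i → H_i → 0. -/
theorem frobChar_cyclesRep (G : Graph α β) (i j : ℕ) :
    frobChar (cyclesRep G i j)
      = frobChar (boundariesRep G i j) + frobChar (homologyRep G i j) :=
  frobChar_eq_add_of_exact (ι := Submodule.inclusion (boundaries_le_cycles G i j))
    (p := ((boundaries G i j).submoduleOf (cycles G i j)).mkQ)
    (Submodule.inclusion_injective _) (Submodule.mkQ_surjective _)
    (fun x => (Submodule.Quotient.mk_eq_zero _).trans
      ⟨fun h => ⟨⟨x, h⟩, rfl⟩, by rintro ⟨y, rfl⟩; exact y.2⟩)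
    (fun g => rfl) (fun g => rfl)

/-- Truncated Euler-Poincaré formula: the boundary terms telescope, and only the one in the top
degree N survives. -/
theorem sum_frobChar_homologyRep_add (G : Graph α β) (j N : ℕ) :
    ∑ i ∈ Finset.range (N + 1), (-1) ^ i * frobChar (homologyRep G i j)
        + (-1) ^ N * frobChar (boundariesRep G N j)
      = ∑ i ∈ Finset.range (N + 1), (-1) ^ i * frobChar (chainRep G i j) := by
  induction N with
  | zero => simp [frobChar_chainRep_zero, frobChar_cyclesRep, add_comm]
  | succ N ih =>
    rw [Finset.sum_range_succ, Finset.sum_range_succ _ (N + 1), ← ih, frobChar_chainRep_succ,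
      frobChar_cyclesRep]
    ring

/-- No state has more than |E(G)| edges, so the differential into the top degree has zero source and
the leftover telescoping term vanishes. -/
theorem frobChar_boundariesRep_ncard (G : Graph α β) (j : ℕ) :
    frobChar (boundariesRep G E(G).ncard j) = 0 := by
  have h : IsEmpty (State G (E(G).ncard + 1)) := ⟨fun F => by
    have := card_le_ncard_edgeSet F.2.1
    have := F.2.2
    omega⟩
  have : Subsingleton (boundaries G E(G).ncard j) := by
    refine ⟨?_⟩
    rintro ⟨_, x, rfl⟩ ⟨_, y, rfl⟩
    have hxy : x = y := DFinsupp.ext fun F => h.elim F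
    subst hxy
    rfl
  exact frobChar_of_subsingleton _

theorem sum_frobChar_homologyRep (G : Graph α β) (j : ℕ) :
    ∑ i ∈ Finset.range (E(G).ncard + 1), (-1) ^ i * frobChar (homologyRep G i j)
      = eulerSum G j := by
  classical
  have h := sum_frobChar_homologyRep_add G j E(G).ncard
  rw [frobChar_boundariesRep_ncard, mul_zero, add_zero] at h
  -- The states are grouped by their number of edges, which matches the chain modules degree by
  -- degree.
  rw [h, eulerSum, ← Finset.sum_fiberwise_of_maps_to (g := Finset.card)
    (t := Finset.range (E(G).ncard + 1)) fun F hF =>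
      Finset.mem_range_succ_iff.2 (card_le_ncard_edgeSet (Finset.mem_filter.1 hF).2)]
  refine Finset.sum_congr rfl fun i _ => ?_
  rw [chainRep, frobChar_directSum, Finset.mul_sum,
    Finset.sum_subtype (F := inferInstanceAs (Fintype (State G i)))
      (p := fun F : Finset β => (F : Set β) ⊆ E(G) ∧ F.card = i) _ (fun F => by simp)]
  refine Finset.sum_congr rfl fun F _ => ?_
  rw [F.2.2]

theorem eval_one_frobSeries (G : Graph α β) :
    (frobSeries G).eval 1
      = ∑ j ∈ Finset.range (V(G).ncard + 1), Polynomial.monomial j ((-1) ^ j * eulerSum G j) := by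
  rw [frobSeries, Finset.sum_comm, Polynomial.eval_finsetSum]
  refine Finset.sum_congr rfl fun j _ => ?_
  rw [Polynomial.eval_finsetSum, ← sum_frobChar_homologyRep, Finset.mul_sum, map_sum]
  refine Finset.sum_congr rfl fun i _ => ?_
  rw [Polynomial.eval_monomial, one_pow, mul_one, pow_add, mul_comm ((-1) ^ i), mul_assoc]

/-! ### The triangle -/

open Classical in
theorem eulerSum_triangle (G : Graph α β)
    {x y z : α} {e₁ e₂ e₃ : β} (hxy : x ≠ y) (hyz : y ≠ z) (hzx : z ≠ x)
    (h₁ : G.IsLink e₁ x y) (h₂ : G.IsLink e₂ y z) (h₃ : G.IsLink e₃ z x) (j : ℕ) :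
    eulerSum G j = eulerSum (G.deleteEdges {e₁}) j + eulerSum (G.deleteEdges {e₂}) j
      - eulerSum (G.deleteEdges {e₁, e₂}) j := by
  -- These inequalities ensure that toggling e₃ does not change whether e₁ and e₂ belong to F.
  have h13 : e₁ ≠ e₃ := by
    rintro rfl
    rcases h₁.eq_and_eq_or_eq_and_eq h₃ with ⟨h, -⟩ | ⟨-, h⟩
    exacts [hzx h.symm, hyz h]
  have h23 : e₂ ≠ e₃ := by
    rintro rfl
    rcases h₂.eq_and_eq_or_eq_and_eq h₃ with ⟨h, -⟩ | ⟨h, -⟩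
    exacts [hyz h, hxy h.symm]
  set φ : Finset β → SymmSeries := fun F =>
    (-1) ^ F.card * frobChar (indRep (components G F) j) with hφ
  have key : ∑ F ∈ Finset.univ.filter fun F : Finset β => (F : Set β) ⊆ E(G) ∧ e₁ ∈ F ∧ e₂ ∈ F, φ F = 0 := by
    have hins : ∀ F : Finset β, e₁ ∈ F → e₂ ∈ F → e₃ ∉ F → φ F + φ (insert e₃ F) = 0 := by
      intro F m₁ m₂ m₃
      -- The path x, y, z along e₁ and e₂ already joins the ends of e₃.
      have hc : components G (insert e₃ F) = components G F :=
        components_insert (u := ⟨z, h₃.left_mem⟩) (v := ⟨x, h₃.right_mem⟩) h₃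
          ((components G F).symm ((components G F).trans
            (Relation.EqvGen.rel (⟨x, h₁.left_mem⟩ : V(G)) ⟨y, h₁.right_mem⟩ ⟨e₁, m₁, h₁⟩)
            (Relation.EqvGen.rel _ _ ⟨e₂, m₂, h₂⟩)))
      rw [hφ]
      dsimp only
      rw [hc, Finset.card_insert_of_notMem m₃, pow_succ]
      ring
    -- Toggling e₃ is a sign-reversing involution without fixed points on the states containing e₁
    -- and e₂.
    refine Finset.sum_involution (fun F _ => if e₃ ∈ F then F.erase e₃ else insert e₃ F)
      ?_ ?_ ?_ ?_
    · intro F hF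
      obtain ⟨-, m₁, m₂⟩ := (Finset.mem_filter.1 hF).2
      split_ifs with m₃
      · have h := hins (F.erase e₃) (Finset.mem_erase.2 ⟨h13, m₁⟩)
          (Finset.mem_erase.2 ⟨h23, m₂⟩) (Finset.notMem_erase _ _)
        rwa [Finset.insert_erase m₃, add_comm] at h
      · exact hins F m₁ m₂ m₃
    · intro F _ _ h
      split_ifs at h with m₃
      · exact Finset.erase_eq_self.1 h m₃
      · exact m₃ (Finset.insert_eq_self.1 h)
    · intro F hF
      obtain ⟨hE, m₁, m₂⟩ := (Finset.mem_filter.1 hF).2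
      refine Finset.mem_filter.2 ⟨Finset.mem_univ _, ?_⟩
      split_ifs with m₃
      · exact ⟨fun e he => hE (Finset.mem_of_mem_erase he), by simp [m₁, m₂, h13, h23]⟩
      · refine ⟨fun e he => ?_, by simp [m₁, m₂]⟩
        rcases Finset.mem_insert.1 he with rfl | he
        exacts [h₃.edge_mem, hE he]
    · intro F _
      by_cases m₃ : e₃ ∈ F <;> simp [m₃, Finset.insert_erase]
  rw [eulerSum_deleteEdges, eulerSum_deleteEdges, eulerSum_deleteEdges, eulerSum, eq_sub_iff_add_eq,
    ← sub_eq_zero]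
  change ∑ F ∈ Finset.univ.filter fun F : Finset β => (F : Set β) ⊆ E(G), φ F
      + ∑ F ∈ Finset.univ.filter fun F : Finset β => (F : Set β) ⊆ E(G) \ {e₁, e₂}, φ F
      - (∑ F ∈ Finset.univ.filter fun F : Finset β => (F : Set β) ⊆ E(G) \ {e₁}, φ F
        + ∑ F ∈ Finset.univ.filter fun F : Finset β => (F : Set β) ⊆ E(G) \ {e₂}, φ F) = 0
  -- With 0 replaced by the sum in `key`, inclusion-exclusion holds summand by summand, by cases on
  -- whether F lies in `E(G)` and contains e₁ or e₂.
  rw [← key]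
  simp only [Finset.sum_filter, ← Finset.sum_add_distrib, ← Finset.sum_sub_distrib]
  refine Finset.sum_congr rfl fun F _ => ?_
  by_cases hE : (F : Set β) ⊆ E(G) <;> by_cases m₁ : e₁ ∈ F <;> by_cases m₂ : e₂ ∈ F <;>
    simp [Set.subset_sdiff, hE, m₁, m₂]

end ChromaticHomology

end

open ChromaticHomology in
theorem mainTheorem4 {α β : Type*} [Fintype α] [Fintype β] [LinearOrder β] (G : Graph α β)
    (x y z : α) (e₁ e₂ e₃ : β) (hxy : x ≠ y) (hyz : y ≠ z) (hzx : z ≠ x)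
    (h₁ : G.IsLink e₁ x y) (h₂ : G.IsLink e₂ y z) (h₃ : G.IsLink e₃ z x) :
    (ChromaticHomology.frobSeries G).eval 1 =
      (ChromaticHomology.frobSeries (G.deleteEdges {e₁})).eval 1 +
        (ChromaticHomology.frobSeries (G.deleteEdges {e₂})).eval 1 -
        (ChromaticHomology.frobSeries (G.deleteEdges {e₁, e₂})).eval 1 := by
  simp only [eval_one_frobSeries]
  -- Deleting edges keeps the vertex set definitionally, so all the sums over j share one range.
  change _ = ∑ j ∈ Finset.range (V(G).ncard + 1), _ + ∑ j ∈ Finset.range (V(G).ncard + 1), _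
    - ∑ j ∈ Finset.range (V(G).ncard + 1), _
  rw [← Finset.sum_add_distrib, ← Finset.sum_sub_distrib]
  refine Finset.sum_congr rfl fun j _ => ?_
  rw [eulerSum_triangle G hxy hyz hzx h₁ h₂ h₃, ← map_add, ← map_sub, mul_sub, mul_add]
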